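/- **Set cover with $\lambda$ outliers.** An instance consists of sets $S_1,\dots,S_n\subseteq\mathcal E$ with $|\mathcal E|=m\ge 1$, $n\ge 1$ and $\bigcup_i S_i=\mathcal E$. For $\alpha\ge 1$ and $\lambda>0$, an *$\alpha$-approximate solution to set cover with $\lambda$ outliers* is a subfamily that covers at least $(1-\lambda)m$ elements and contains at most $\alpha\cdot\mathrm{OPT}$ sets, where $\mathrm{OPT}$ is the smallest number of the sets whose union is all of $\mathcal E$. **Model.** The edges (pairs $(S_i,v)$ with $v\in S_i$) are split arbitrarily across $t\ge m$ machines, each edge being on exactly one machine and at most $n$ edges on each machine. In each round every machine receives the messages sent to it in the previous round, performs an arbitrary randomized computation with its own independent random choices, updates its memory and sends messages to the machines; after the last round one designated machine reports a subfamily. Memory and messages consist of words, a word being an edge or an integer in $\{0,\dots,nm\}$ (so $O(\log (nm))$ bits, when $nm\ge 2$). The space used by a machine in a round is the total number of words that it stores at the beginning, receives, stores at the end, and sends. **Theorem.** There is an absolute constant $c$ such that for all $\varepsilon\in(0,1]$ and $\lambda>0$ with $(1+\varepsilon)\ln\frac1\lambda\ge 1$ there is a constant $C=C(\varepsilon,\lambda)$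 with the following property. For all $n,m\ge 1$ and $t\ge m$ there is a four-round distributed algorithm on $t$ machines (depending on $\varepsilon,\lambda,n,m,t$ only) such that, on every instance with $n$ sets and $m$ elements and for every initial distribution of its edges as above, * each machine uses at most $C\,n\,(1+\ln n)^c=\tilde O(n)$ words of space in each round, for every outcome of the random choices, and * with probability at least $1-\frac2n$ the algorithm reports a $(1+\varepsilon)\ln\frac1\lambda$-approximate solution to set cover with $\lambda$ outliers. -/

import Mathlib

/-! ### Coverage instances

A coverage instance with `n` sets over a ground set of `m` elements is an indexed family
`I : Fin n → Finset (Fin m)`. A solution is the set `T : Finset (Fin n)` of the indices chosen. -/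

/-- The coverage function: the number of elements in the union of the chosen sets. -/
def coverage {n m : ℕ} (I : Fin n → Finset (Fin m)) (T : Finset (Fin n)) : ℕ :=
  (T.biUnion I).card

/-- The chosen sets cover every element. -/
def IsSetCover {n m : ℕ} (I : Fin n → Finset (Fin m)) (T : Finset (Fin n)) : Prop :=
  T.biUnion I = Finset.univ

/-- The chosen sets cover at least a `1 - lam` fraction of the elements. -/
def IsOutlierCover {n m : ℕ} (lam : ℝ) (I : Fin n → Finset (Fin m)) (T : Finset (Fin n)) : Prop :=
  (1 - lam) * (m : ℝ) ≤ (coverage I T : ℝ)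

/-- `T` is an `α`-approximate solution to set cover with `lam` outliers: it covers at least a
`1 - lam` fraction of the elements, and it has at most `α` times as many sets as
a smallest set cover. -/
def IsApproxOutlierCover {n m : ℕ} (α lam : ℝ) (I : Fin n → Finset (Fin m))
    (T : Finset (Fin n)) : Prop :=
  IsOutlierCover lam I T ∧
    ∀ T' : Finset (Fin n), IsSetCover I T' → (T.card : ℝ) ≤ α * (T'.card : ℝ)

/-! ### Distributed algorithms -/

/-- A machine word: an edge (set, element) of the incidence graph, or a number that is at
most `n * m`. There are `2 * n * m + 1` words, so that a word has `O(log (n * m))` bits. -/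
abbrev Word (n m : ℕ) : Type := (Fin n × Fin m) ⊕ Fin (n * m + 1)

/-- A randomized distributed algorithm with `R` rounds on `t` machines, for instances with `n` sets
and `m` elements. In each round, each machine reads its memory, the messages sent to it in the
previous round (indexed by their senders) and a fresh random seed; it then computes its new memory
and the messages it sends (indexed by their receivers). The empty message stands for no message.
After the last round, the leader reports a solution computed from its own memory. -/
structure DistAlg (n m t R : ℕ) where
  /-- The finite set from which each machine draws a seed, uniformly, in each round. -/
  Seed : Type
  [seedFintype : Fintype Seed]
  [seedNonempty : Nonempty Seed]
  step : Fin R → Fin t → List (Word n m) → (Fin t → List (Word n m)) → Seed →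
    List (Word n m) × (Fin t → List (Word n m))
  leader : Fin t
  report : List (Word n m) → Finset (Fin n)

/-- A global state between two rounds: the memory of each machine, and the messages under way,
`inbox i j` being the one that `i` receives from `j`. -/
structure Config (n m t : ℕ) where
  mem : Fin t → List (Word n m)
  inbox : Fin t → Fin t → List (Word n m)

/-- `D` splits the edges of `I` across `t` machines: each edge of the incidence graph occurs exactly
once in total, and nothing else occurs. -/
def IsDistribution {n m t : ℕ} (I : Fin n → Finset (Fin m))
    (D : Fin t → List (Fin n × Fin m)) : Prop :=
  ∀ (S : Fin n) (v : Fin m), ∑ i : Fin t, (D i).count (S, v) = if v ∈ I S then 1 else 0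

namespace DistAlg

variable {n m t R : ℕ}

/-- The randomness of a run: one seed for each round and each machine. -/
abbrev Outcome (A : DistAlg n m t R) : Type := Fin R → Fin t → A.Seed

/-- The state after `r` rounds (`r ≤ R`), on the input distribution `D` and the seeds `ω`. -/
def config (A : DistAlg n m t R) (D : Fin t → List (Fin n × Fin m)) (ω : A.Outcome) :
    ℕ → Config n m t
  | 0 => { mem := fun i => (D i).map Sum.inl, inbox := fun _ _ => [] }
  | r + 1 =>
    let c := A.config D ω r
    if h : r < R then
      let out := fun i => A.step ⟨r, h⟩ i (c.mem i) (c.inbox i) (ω ⟨r, h⟩ i)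
      { mem := fun i => (out i).1, inbox := fun i j => (out j).2 i }
    else c

/-- The load, in words, of machine `i` in the round with index `r`: the memory it starts with, the
messages it receives, the memory it keeps, and the messages it sends. -/
def load (A : DistAlg n m t R) (D : Fin t → List (Fin n × Fin m)) (ω : A.Outcome)
    (r : Fin R) (i : Fin t) : ℕ :=
  ((A.config D ω r).mem i).length + ∑ j : Fin t, ((A.config D ω r).inbox i j).length +
    ((A.config D ω (r + 1)).mem i).length + ∑ j : Fin t, ((A.config D ω (r + 1)).inbox j i).length

/-- The solution reported after the last round. -/
def output (A : DistAlg n m t R) (D : Fin t → List (Fin n × Fin m)) (ω : A.Outcome) :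
    Finset (Fin n) :=
  A.report ((A.config D ω R).mem A.leader)

open Classical in
/-- The probability, over independent and uniform seeds, that the reported solution satisfies `P`:
the number of favourable outcomes divided by the number of outcomes. -/
noncomputable def prob (A : DistAlg n m t R) (D : Fin t → List (Fin n × Fin m))
    (P : Finset (Fin n) → Prop) : ℝ :=
  letI := A.seedFintype
  ((Finset.univ.filter fun ω : A.Outcome => P (A.output D ω)).card : ℝ) /
    (Fintype.card A.Outcome : ℝ)

end DistAlg

/-!
Local computation is unrestricted, so the leader may search through all families of sets. The
theorem therefore reduces to collecting, in `Õ(n)` words, a sketch of the instance from which the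
leader can tell which families of at most `OPT` sets cover a `1 - lam` fraction of the elements.
The reported family even has at most `OPT` sets, which suffices as `(1 + ε) * log (1 / lam) ≥ 1`.

Families of `k` sets are judged at the scale `j = Nat.log 2 k`, by a sample of about
`2 ^ j * log n / lam` independent uniform elements. Of each sampled element, the leader learns only
the first `degCap n B j`, that is `O(n / 2 ^ j)`, of the sets that contain it. Each scale then costs
`O(n * log n)` words and there are `O(log n)` scales (`CoverAlg.reportBound_le`). The size of the
sample is fixed, so that the bound on the space holds for every outcome of the random choices. The
machine `owner v` assembles the neighbourhood of the element `v`, which has at most `n` words, and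
truncates it.

The leader returns a smallest family that misses at most a `lam / 4` fraction of the sample at its
scale, with respect to the capped neighbourhoods. Two facts make this correct.

* Capping costs little (`exists_card_eq_missed_le`). Let `T` be a set cover with `k` sets. Dropping
  the `⌊γ * k⌋` members of `T` that matter least loses a `γ` fraction of the elements. The same
  number of greedily chosen sets covers all but a `γ` fraction of the elements that were actually
  capped, because these lie in many sets even after capping. So there is a family of exactly `k`
  sets that misses at most a `2 * γ` fraction of the capped instance.
* Samples are reliable. With exponential moments (`sum_exp_card_filter`), the family just described
  is accepted except with probability `1 / n`, and a family `T` that misses a `lam` fraction of the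
  capped instance is accepted with probability at most `n ^ (-3 * |T|)`. The union bound over all
  nonempty `T` gives another `1 / n` (`card_bad_accepted_le`). Covering an element in the capped
  instance implies covering it in the original one.
-/

/-! ### Capped neighbourhoods and set covers -/

open Finset in
/-- Some `r` of the values `a`, namely the smallest ones, sum to at most an `r / T.card` fraction of the total. -/
theorem exists_subset_card_sum_le {ι : Type*} [DecidableEq ι] (T : Finset ι) (a : ι → ℝ) (r : ℕ)
    (hr : r ≤ T.card) :
    ∃ R ⊆ T, R.card = r ∧ (T.card : ℝ) * ∑ S ∈ R, a S ≤ r * ∑ S ∈ T, a S := by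
  induction r with
  | zero => exact ⟨∅, by simp, by simp, by simp⟩
  | succ r ih =>
    obtain ⟨R, hRT, hRr, hR⟩ := ih (by omega)
    have hcard : (T \ R).card = T.card - r := by rw [card_sdiff_of_subset hRT, hRr]
    have hne : (T \ R).Nonempty := by rw [← card_pos]; omega
    obtain ⟨S, hS, hmin⟩ := exists_min_image (T \ R) a hne
    rw [mem_sdiff] at hS
    have h1 : ((T.card : ℝ) - r) * a S ≤ ∑ S ∈ T, a S - ∑ S ∈ R, a S := by
      have h := card_nsmul_le_sum (T \ R) a (a S) hmin
      have h2 := sum_sdiff (f := a) hRT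
      rw [nsmul_eq_mul, hcard, Nat.cast_sub (by omega)] at h
      linarith
    have hpos : (0 : ℝ) < (T.card : ℝ) - r := by
      have : (r : ℝ) + 1 ≤ T.card := by exact_mod_cast hr
      linarith
    refine ⟨insert S R, insert_subset hS.1 hRT, by rw [card_insert_of_notMem hS.2, hRr], ?_⟩
    rw [sum_insert hS.2]
    push_cast
    refine le_of_mul_le_mul_left ?_ hpos
    have hr1 : (0 : ℝ) ≤ (T.card : ℝ) - r - 1 := by
      have : (r : ℝ) + 1 ≤ T.card := by exact_mod_cast hr
      linarith
    nlinarith [mul_le_mul_of_nonneg_left h1 (Nat.cast_nonneg (α := ℝ) T.card),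
      mul_le_mul_of_nonneg_left hR hr1]

/-- The sets that contain the element `v`. -/
def nbhd {n m : ℕ} (I : Fin n → Finset (Fin m)) (v : Fin m) : Finset (Fin n) :=
  Finset.univ.filter fun S => v ∈ I S

/-- The first `d` of the sets that contain `v`, or all of them if there are at most `d`. -/
def cappedNbhd {n m : ℕ} (I : Fin n → Finset (Fin m)) (d : ℕ) (v : Fin m) : List (Fin n) :=
  ((nbhd I v).sort (· ≤ ·)).take d

/-- The elements that no member of `T` covers in the capped instance, in which each element belongs
only to the sets in its `cappedNbhd`. -/
def missed {n m : ℕ} (I : Fin n → Finset (Fin m)) (d : ℕ) (T : Finset (Fin n)) :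
    Finset (Fin m) :=
  Finset.univ.filter fun v => ∀ S ∈ T, S ∉ cappedNbhd I d v

theorem mem_of_mem_cappedNbhd {n m : ℕ} {I : Fin n → Finset (Fin m)} {d : ℕ} {v : Fin m}
    {S : Fin n} (h : S ∈ cappedNbhd I d v) : v ∈ I S := by
  have := List.mem_of_mem_take h
  simpa [nbhd] using this

/-- An element is either left intact by the capping or lies in exactly `d` sets afterwards. -/
theorem cappedNbhd_intact_or_card {n m : ℕ} (I : Fin n → Finset (Fin m)) (d : ℕ) (v : Fin m) :
    (∀ S, v ∈ I S → S ∈ cappedNbhd I d v) ∨ (cappedNbhd I d v).toFinset.card = d := by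
  rcases le_total (nbhd I v).card d with h | h
  · left
    intro S hS
    rw [cappedNbhd, List.take_of_length_le (by simpa using h)]
    simpa [nbhd] using hS
  · right
    rw [cappedNbhd, List.toFinset_card_of_nodup ((Finset.sort_nodup _ _).take), List.length_take,
      Finset.length_sort]
    omega

/-- Membership in a capped neighbourhood implies membership in the neighbourhood, hence every element
not missed in the capped instance is covered. -/
theorem coverage_add_missed_ge {n m : ℕ} (I : Fin n → Finset (Fin m)) (d : ℕ)
    (T : Finset (Fin n)) : m ≤ coverage I T + (missed I d T).card := by
  have h : (Finset.univ : Finset (Fin m)) ⊆ T.biUnion I ∪ missed I d T := by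
    intro v _
    by_cases hv : v ∈ T.biUnion I
    · exact Finset.mem_union_left _ hv
    · refine Finset.mem_union_right _ ?_
      simp only [missed, Finset.mem_filter, Finset.mem_univ, true_and]
      intro S hS hc
      exact hv (Finset.mem_biUnion.2 ⟨S, hS, mem_of_mem_cappedNbhd hc⟩)
  have := (Finset.card_le_card h).trans (Finset.card_union_le _ _)
  simpa [coverage] using this

open Finset in
/-- Greedy covering: if each element of `H` lies in exactly `d` of the `n` sets, then some set
contains a `d / n` fraction of what is left of `H`, so that `r` sets leave at most a fraction
`exp (-r * d / n)` of `H`. -/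
theorem exists_greedy_cover {n m : ℕ} (N : Fin m → Finset (Fin n)) (d : ℕ) (H : Finset (Fin m))
    (hH : ∀ v ∈ H, (N v).card = d) (r : ℕ) :
    ∃ G : Finset (Fin n), G.card ≤ r ∧
      ((H.filter fun v => ∀ S ∈ G, S ∉ N v).card : ℝ) ≤
        Real.exp (-(d / n)) ^ r * H.card := by
  induction r with
  | zero => exact ⟨∅, by simp, by simp⟩
  | succ r ih =>
    obtain ⟨G, hGr, hG⟩ := ih
    set W := H.filter fun v => ∀ S ∈ G, S ∉ N v with hW
    rcases Nat.eq_zero_or_pos n with rfl | hn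
    · refine ⟨G, by omega, hG.trans ?_⟩
      simp
    -- double counting of the pairs of a set and an element of `W` in it
    have hdc : ∑ S : Fin n, ((W.filter fun v => S ∈ N v).card : ℝ) = d * W.card := by
      have : ∑ S : Fin n, (W.filter fun v => S ∈ N v).card = d * W.card := by
        simp only [card_filter]
        rw [sum_comm]
        have : ∀ v ∈ W, (∑ S : Fin n, if S ∈ N v then 1 else 0) = d := by
          intro v hv
          rw [← hH v (mem_filter.1 hv).1, ← card_filter]
          congr 1
          ext; simp
        rw [sum_congr rfl this]
        simp [mul_comm]
      exact_mod_cast this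
    have hn' : (0 : ℝ) < n := by exact_mod_cast hn
    obtain ⟨S, -, hS⟩ := exists_le_of_sum_le (s := (univ : Finset (Fin n)))
      (f := fun _ => (d : ℝ) * W.card / n) (g := fun S => ((W.filter fun v => S ∈ N v).card : ℝ))
      ⟨⟨0, hn⟩, mem_univ _⟩ (by
        rw [hdc]; simp; field_simp; exact le_refl _)
    refine ⟨insert S G, (card_insert_le _ _).trans (by omega), ?_⟩
    have hsplit := card_filter_add_card_filter_not (s := W) (fun v => S ∈ N v)
    have heq : (H.filter fun v => ∀ S' ∈ insert S G, S' ∉ N v) = W.filter fun v => ¬ S ∈ N v := by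
      ext v
      simp only [hW, mem_filter, mem_insert, forall_eq_or_imp]
      tauto
    have hsplit' : ((W.filter fun v => S ∈ N v).card : ℝ) + (W.filter fun v => ¬ S ∈ N v).card
        = W.card := by exact_mod_cast hsplit
    rw [heq, pow_succ]
    have h1 := Real.add_one_le_exp (-((d : ℝ) / n))
    have h2 : (0 : ℝ) ≤ W.card := Nat.cast_nonneg _
    calc ((W.filter fun v => ¬ S ∈ N v).card : ℝ) ≤ (-((d : ℝ) / n) + 1) * W.card := by
          have : (d : ℝ) * W.card / n = d / n * W.card := by ring
          linarith
      _ ≤ Real.exp (-(d / n)) * W.card := by gcongr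
      _ ≤ Real.exp (-(d / n)) * (Real.exp (-(d / n)) ^ r * H.card) := by gcongr
      _ = _ := by ring

open Finset in
/-- Among the families of exactly `k` sets, where `k` is the size of some set cover, one misses few
elements of the capped instance. It arises from the cover by dropping the `⌊γ * k⌋` sets that
matter least, which costs a `γ` fraction of the elements, and by adding as many greedy sets to catch
the elements whose degree was capped. -/
theorem exists_card_eq_missed_le {n m : ℕ} (I : Fin n → Finset (Fin m)) (T : Finset (Fin n))
    (hT : IsSetCover I T) {γ : ℝ} (hγ : 0 < γ) (hγ1 : γ ≤ 1) {d : ℕ} (hk : 0 < T.card)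
    (hd : 2 / γ ^ 2 * n ≤ d * T.card) :
    ∃ T₀ : Finset (Fin n), T₀.card = T.card ∧ ((missed I d T₀).card : ℝ) ≤ 2 * γ * m := by
  have hn : 0 < n := lt_of_lt_of_le hk (by simpa using card_le_univ T)
  have hn' : (0 : ℝ) < n := by exact_mod_cast hn
  have hk' : (0 : ℝ) < T.card := by exact_mod_cast hk
  have hassign : ∀ v : Fin m, ∃ S ∈ T, v ∈ I S := by
    intro v
    have : v ∈ T.biUnion I := by rw [hT]; exact mem_univ v
    simpa using this
  -- `f` assigns each element to one member of the cover; the importance of a member is the number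
  -- of elements assigned to it
  choose f hfT hf using hassign
  obtain ⟨r, hr⟩ : ∃ r, r = ⌊γ * T.card⌋₊ := ⟨_, rfl⟩
  have hrle : (r : ℝ) ≤ γ * T.card := by rw [hr]; exact Nat.floor_le (by positivity)
  have hrT : r ≤ T.card := by
    have : (r : ℝ) ≤ T.card := hrle.trans (by nlinarith)
    exact_mod_cast this
  obtain ⟨R, hRT, hRr, hR⟩ := exists_subset_card_sum_le T
    (fun S => ((univ.filter fun v => f v = S).card : ℝ)) r hrT
  have hlost : ((univ.filter fun v => f v ∈ R).card : ℝ) ≤ γ * m := by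
    have h1 : ∑ S ∈ T, ((univ.filter fun v => f v = S).card : ℝ) = m := by
      have := card_eq_sum_card_fiberwise (f := f) (s := univ) (t := T) (fun v _ => hfT v)
      rw [card_univ, Fintype.card_fin] at this
      exact_mod_cast this.symm
    have h2 : ∑ S ∈ R, ((univ.filter fun v => f v = S).card : ℝ) =
        (univ.filter fun v => f v ∈ R).card := by
      have := card_eq_sum_card_fiberwise (f := f) (s := univ.filter fun v => f v ∈ R) (t := R)
        (fun v hv => by simpa using hv)
      rw [this]
      push_cast
      refine sum_congr rfl fun S hS => ?_
      congr 2
      ext v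
      simp only [mem_filter, mem_univ, true_and]
      constructor
      · rintro rfl; exact ⟨hS, rfl⟩
      · exact fun h => h.2
    rw [h1, h2] at hR
    have hm0 : (0 : ℝ) ≤ m := Nat.cast_nonneg _
    refine le_of_mul_le_mul_left (hR.trans ?_) hk'
    nlinarith
  obtain ⟨G, hGr, hG⟩ := exists_greedy_cover (fun v => (cappedNbhd I d v).toFinset) d
    (univ.filter fun v => (cappedNbhd I d v).toFinset.card = d ∧
      ¬ ∀ S, v ∈ I S → S ∈ cappedNbhd I d v) (by simp +contextual) r
  have hcaught : ((univ.filter fun v => ((cappedNbhd I d v).toFinset.card = d ∧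
      ¬ ∀ S, v ∈ I S → S ∈ cappedNbhd I d v) ∧ ∀ S ∈ G, S ∉ cappedNbhd I d v).card : ℝ)
      ≤ γ * m := by
    rcases lt_or_ge (γ * T.card) 1 with hsmall | hbig
    · -- the cap exceeds `n`, hence every element is intact
      have hdn : (n : ℝ) < d := by
        have h3 : 2 / γ ^ 2 * n * γ ≤ d * (γ * T.card) := by
          calc _ ≤ d * T.card * γ := by gcongr
            _ = _ := by ring
        have h4 : 2 / γ ^ 2 * n * γ = 2 * n / γ := by field_simp
        have h5 : 2 * (n : ℝ) ≤ 2 * n / γ := by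
          rw [le_div_iff₀ hγ]; nlinarith
        have h6 : (d : ℝ) * (γ * T.card) ≤ d := by
          have : (0 : ℝ) ≤ d := Nat.cast_nonneg _
          nlinarith
        linarith
      have hdn' : n < d := by exact_mod_cast hdn
      have : (univ.filter fun v => ((cappedNbhd I d v).toFinset.card = d ∧
          ¬ ∀ S, v ∈ I S → S ∈ cappedNbhd I d v) ∧ ∀ S ∈ G, S ∉ cappedNbhd I d v) = ∅ := by
        rw [filter_eq_empty_iff]
        rintro v - ⟨⟨h, -⟩, -⟩
        have := card_le_univ (cappedNbhd I d v).toFinset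
        rw [Fintype.card_fin] at this
        omega
      rw [this]
      simp only [card_empty, Nat.cast_zero]
      positivity
    · -- rounding down at most halves `γ * T.card`, and the greedy factor `exp (-r * d / n)` is then
      -- at most `exp (-1 / γ) ≤ γ`
      have hr2 : γ * T.card / 2 ≤ r := by
        have h3 : 1 ≤ r := by rw [hr]; exact Nat.le_floor (by simpa using hbig)
        have h4 : γ * T.card < r + 1 := by rw [hr]; exact Nat.lt_floor_add_one _
        have h5 : (1 : ℝ) ≤ r := by exact_mod_cast h3
        linarith
      have hexp : 1 / γ ≤ r * (d / n) := by
        calc 1 / γ = γ / 2 * (2 / γ ^ 2 * n) / n := by field_simp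
          _ ≤ γ / 2 * (d * T.card) / n := by gcongr
          _ = γ * T.card / 2 * (d / n) := by ring
          _ ≤ _ := by gcongr
      have hfac : Real.exp (-(d / n)) ^ r ≤ γ := by
        rw [← Real.exp_nat_mul]
        calc Real.exp (r * -(d / n)) ≤ Real.exp (-(1 / γ)) := by
              apply Real.exp_le_exp.2; linarith
          _ ≤ γ := by
              rw [Real.exp_neg]
              refine inv_le_of_inv_le₀ hγ ?_
              have := Real.add_one_le_exp (1 / γ)
              rw [one_div] at this ⊢
              linarith
      rw [filter_filter] at hG
      simp only [List.mem_toFinset] at hG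
      refine hG.trans ?_
      have hc : ((univ.filter fun v => (cappedNbhd I d v).toFinset.card = d ∧
          ¬ ∀ S, v ∈ I S → S ∈ cappedNbhd I d v).card : ℝ) ≤ m := by
        have := card_le_univ (univ.filter fun v => (cappedNbhd I d v).toFinset.card = d ∧
          ¬ ∀ S, v ∈ I S → S ∈ cappedNbhd I d v)
        rw [Fintype.card_fin] at this
        exact_mod_cast this
      gcongr
  -- the family is filled up to exactly `T.card` sets, so that it is judged at the scale of `T.card`
  obtain ⟨T₀, hsub, hcard⟩ := exists_superset_card_eq (s := G ∪ T \ R) (n := T.card)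
    ((card_union_le _ _).trans (by rw [card_sdiff_of_subset hRT]; omega))
    (by simpa using card_le_univ T)
  refine ⟨T₀, hcard, ?_⟩
  have hcover : missed I d T₀ ⊆ (univ.filter fun v => f v ∈ R) ∪
      (univ.filter fun v => ((cappedNbhd I d v).toFinset.card = d ∧
        ¬ ∀ S, v ∈ I S → S ∈ cappedNbhd I d v) ∧ ∀ S ∈ G, S ∉ cappedNbhd I d v) := by
    intro v hv
    simp only [missed, mem_filter, mem_univ, true_and] at hv
    simp only [mem_union, mem_filter, mem_univ, true_and]
    by_cases hfull : ∀ S, v ∈ I S → S ∈ cappedNbhd I d v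
    · left
      by_contra hvR
      exact hv (f v) (hsub (mem_union_right _ (mem_sdiff.2 ⟨hfT v, hvR⟩))) (hfull _ (hf v))
    · right
      exact ⟨⟨(cappedNbhd_intact_or_card I d v).resolve_left hfull, hfull⟩,
        fun S hS => hv S (hsub (mem_union_left _ hS))⟩
  have hle : ((missed I d T₀).card : ℝ) ≤ _ :=
    Nat.cast_le.2 ((card_le_card hcover).trans (card_union_le _ _))
  push_cast at hle
  linarith

/-! ### Concentration for uniform samples -/

open Finset in
/-- The moments of the number of sample points that fall into `U`: independence of the
sample points `σ p` turns the sum over all samples into a power. -/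
theorem sum_exp_card_filter {ι : Type*} [Fintype ι] [DecidableEq ι] {m : ℕ} (hm : 0 < m)
    (A : Finset ι) (U : Finset (Fin m)) (s : ℝ) :
    ∑ σ : ι → Fin m, Real.exp (s * (A.filter fun p => σ p ∈ U).card) =
      (1 + U.card / m * (Real.exp s - 1)) ^ A.card * Fintype.card (ι → Fin m) := by
  have hm' : (m : ℝ) ≠ 0 := by exact_mod_cast hm.ne'
  have h1 : ∀ σ : ι → Fin m, Real.exp (s * (A.filter fun p => σ p ∈ U).card) =
      ∏ p, if p ∈ A then (if σ p ∈ U then Real.exp s else 1) else 1 := by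
    intro σ
    rw [prod_ite_mem, univ_inter, prod_ite, prod_const_one, mul_one, prod_const, mul_comm,
      Real.exp_nat_mul]
  have h2 : ∀ p : ι, (∑ v : Fin m, if p ∈ A then (if v ∈ U then Real.exp s else 1) else 1) =
      (if p ∈ A then 1 + U.card / m * (Real.exp s - 1) else 1) * m := by
    intro p
    split_ifs
    · rw [sum_ite, sum_const, sum_const, filter_mem_eq_inter, univ_inter]
      have := card_filter_add_card_filter_not (s := (univ : Finset (Fin m))) (fun v => v ∈ U)
      rw [filter_mem_eq_inter, univ_inter, card_univ, Fintype.card_fin] at this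
      have h3 : ((univ.filter fun v => v ∉ U).card : ℝ) = m - U.card := by
        rw [eq_sub_iff_add_eq']; exact_mod_cast this
      rw [nsmul_eq_mul, nsmul_eq_mul, h3]
      field_simp
      ring
    · simp
  simp_rw [h1]
  rw [← Fintype.piFinset_univ, ← prod_univ_sum (fun _ : ι => (univ : Finset (Fin m)))
    (fun p v => if p ∈ A then (if v ∈ U then Real.exp s else 1) else 1)]
  simp_rw [h2]
  rw [prod_mul_distrib, prod_ite_mem, univ_inter, prod_const, prod_const, card_univ]
  simp

open Finset in
/-- Markov's inequality for `Real.exp (s * X)`, where `X` counts the sample points in `U`. -/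
theorem card_filter_le_of_exp {ι : Type*} [Fintype ι] [DecidableEq ι] {m : ℕ} (hm : 0 < m)
    (A : Finset ι) (U : Finset (Fin m)) (s b : ℝ) (P : (ι → Fin m) → Prop) [DecidablePred P]
    (hP : ∀ σ, P σ → b ≤ s * (A.filter fun p => σ p ∈ U).card) :
    ((univ.filter P).card : ℝ) ≤ Real.exp (-b) *
      ((1 + U.card / m * (Real.exp s - 1)) ^ A.card * Fintype.card (ι → Fin m)) := by
  rw [← sum_exp_card_filter hm, mul_sum]
  calc ((univ.filter P).card : ℝ) = ∑ σ ∈ univ.filter P, 1 := by simp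
    _ ≤ ∑ σ ∈ univ.filter P,
        Real.exp (-b) * Real.exp (s * (A.filter fun p => σ p ∈ U).card) := by
      refine sum_le_sum fun σ hσ => ?_
      rw [← Real.exp_add]
      refine Real.one_le_exp ?_
      linarith [hP σ (mem_filter.1 hσ).2]
    _ ≤ _ := sum_le_sum_of_subset_of_nonneg (subset_univ _) fun _ _ _ => by positivity

open Finset in
/-- Lower tail: a set `U` of density at least `q` is hit by at most a `q / 4` fraction of the
sample points in `A` with exponentially small probability. -/
theorem card_few_hits_le {ι : Type*} [Fintype ι] [DecidableEq ι] {m : ℕ} (hm : 0 < m)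
    (A : Finset ι) (U : Finset (Fin m)) {q : ℝ} (hU : q * m ≤ U.card) :
    ((univ.filter fun σ : ι → Fin m =>
      4 * ((A.filter fun p => σ p ∈ U).card : ℝ) ≤ q * A.card).card : ℝ) ≤
      Real.exp (-(q * A.card / 4)) * Fintype.card (ι → Fin m) := by
  have hm' : (0 : ℝ) < m := by exact_mod_cast hm
  refine (card_filter_le_of_exp hm A U (-1) (-(q * A.card / 4)) _ fun σ hσ => by linarith).trans ?_
  rw [← mul_assoc]
  gcongr
  have hq : q ≤ U.card / m := by rwa [le_div_iff₀ hm']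
  have hU1 : (U.card : ℝ) / m ≤ 1 := by
    rw [div_le_one hm']
    exact_mod_cast (card_le_univ U).trans_eq (Fintype.card_fin m)
  have hU0 : (0 : ℝ) ≤ U.card / m := by positivity
  have he : Real.exp (-1) ≤ 1 / 2 := by
    rw [Real.exp_neg, inv_eq_one_div]
    apply one_div_le_one_div_of_le (by norm_num)
    have := Real.add_one_le_exp (1 : ℝ); linarith
  have hb : 1 + U.card / m * (Real.exp (-1) - 1) ≤ Real.exp (-(q / 2)) := by
    have := Real.add_one_le_exp (-(q / 2))
    nlinarith
  have hb0 : 0 ≤ 1 + U.card / m * (Real.exp (-1) - 1) := by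
    have := Real.exp_pos (-1)
    nlinarith
  calc Real.exp (- -(q * A.card / 4)) * (1 + U.card / m * (Real.exp (-1) - 1)) ^ A.card
      ≤ Real.exp (- -(q * A.card / 4)) * Real.exp (-(q / 2)) ^ A.card := by gcongr
    _ = Real.exp (-(q * A.card / 4)) := by
      rw [← Real.exp_nat_mul, ← Real.exp_add]; congr 1; ring

open Finset in
/-- Upper tail: a set `U` of density at most `q / 12` is hit by more than a `q / 4` fraction of the
sample points in `A` with exponentially small probability. -/
theorem card_many_hits_le {ι : Type*} [Fintype ι] [DecidableEq ι] {m : ℕ} (hm : 0 < m)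
    (A : Finset ι) (U : Finset (Fin m)) {q : ℝ} (hU : (U.card : ℝ) ≤ q / 12 * m) :
    ((univ.filter fun σ : ι → Fin m =>
      ¬ 4 * ((A.filter fun p => σ p ∈ U).card : ℝ) ≤ q * A.card).card : ℝ) ≤
      Real.exp (-(q * A.card / 12)) * Fintype.card (ι → Fin m) := by
  have hm' : (0 : ℝ) < m := by exact_mod_cast hm
  refine (card_filter_le_of_exp hm A U 1 (q * A.card / 4) _ fun σ hσ => by linarith).trans ?_
  rw [← mul_assoc]
  gcongr
  have hq : U.card / m ≤ q / 12 := by rwa [div_le_iff₀ hm']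
  have hU0 : (0 : ℝ) ≤ U.card / m := by positivity
  have he : Real.exp 1 < 3 := Real.exp_one_lt_three
  have he1 : 1 < Real.exp 1 := by
    have := Real.add_one_le_exp (1 : ℝ); linarith
  have hb : 1 + U.card / m * (Real.exp 1 - 1) ≤ Real.exp (q / 6) := by
    have := Real.add_one_le_exp (q / 6)
    nlinarith
  have hb0 : 0 ≤ 1 + U.card / m * (Real.exp 1 - 1) := by nlinarith
  calc Real.exp (-(q * A.card / 4)) * (1 + U.card / m * (Real.exp 1 - 1)) ^ A.card
      ≤ Real.exp (-(q * A.card / 4)) * Real.exp (q / 6) ^ A.card := by gcongr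
    _ = Real.exp (-(q * A.card / 12)) := by
      rw [← Real.exp_nat_mul, ← Real.exp_add]; congr 1; ring

open Finset in
/-- The failure probabilities `n ^ (-3 * |T|)` add up to at most `1 / n`: with the empty family, they
would add up to `(1 + n ^ (-3)) ^ n`. -/
theorem sum_nonempty_pow_card_le {n : ℕ} (hn : 2 ≤ n) :
    ∑ T ∈ (univ : Finset (Finset (Fin n))).filter (·.Nonempty), (((n : ℝ) ^ 3)⁻¹) ^ T.card ≤
      1 / n := by
  have hn' : (2 : ℝ) ≤ n := by exact_mod_cast hn
  have hall : ∑ T : Finset (Fin n), (((n : ℝ) ^ 3)⁻¹) ^ T.card = (1 + ((n : ℝ) ^ 3)⁻¹) ^ n := by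
    have := (prod_one_add (f := fun _ : Fin n => ((n : ℝ) ^ 3)⁻¹) (s := univ))
    simp only [prod_const, card_univ, Fintype.card_fin, powerset_univ] at this
    exact this.symm
  have hsplit := sum_filter_add_sum_filter_not (univ : Finset (Finset (Fin n))) (·.Nonempty)
    (fun T => (((n : ℝ) ^ 3)⁻¹) ^ T.card)
  have hempty : ∑ T ∈ (univ : Finset (Finset (Fin n))).filter (¬ ·.Nonempty),
      (((n : ℝ) ^ 3)⁻¹) ^ T.card = 1 := by
    simp only [not_nonempty_iff_eq_empty]
    rw [filter_eq' univ (∅ : Finset (Fin n))]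
    simp
  have hexp : (1 + ((n : ℝ) ^ 3)⁻¹) ^ n ≤ Real.exp (1 / n ^ 2) := by
    calc (1 + ((n : ℝ) ^ 3)⁻¹) ^ n ≤ Real.exp (((n : ℝ) ^ 3)⁻¹) ^ n := by
          gcongr
          linarith [Real.add_one_le_exp (((n : ℝ) ^ 3)⁻¹)]
      _ = _ := by
          rw [← Real.exp_nat_mul]; congr 1; field_simp
  have h2 : 1 / (n : ℝ) ^ 2 ≤ 1 / n / 2 := by
    rw [div_div]
    apply one_div_le_one_div_of_le (by positivity)
    nlinarith
  have h3 : 1 / (n : ℝ) ≤ 1 := by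
    rw [div_le_one (by linarith)]; linarith
  have h4 := Real.abs_exp_sub_one_le (x := 1 / (n : ℝ) ^ 2) (by
    rw [abs_of_nonneg (by positivity)]; linarith)
  rw [abs_of_nonneg (by positivity : (0:ℝ) ≤ 1 / (n : ℝ) ^ 2)] at h4
  have h5 := (abs_le.1 h4).2
  linarith

/-! ### Scales, messages and owners -/

/-- The number of samples for the solutions with between `2 ^ j` and `2 ^ (j + 1)` sets; there are
no such solutions if `n < 2 ^ j`. -/
def sampleSize (n ℓ j : ℕ) : ℕ := if 2 ^ j ≤ n then 2 ^ (j + 1) * ℓ else 0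

/-- The bound on the number of sets reported for a sample at scale `j`. -/
def degCap (n B j : ℕ) : ℕ := B * (n / 2 ^ j + 1)

/-- The sample points: a scale, and an index within the sample at this scale. -/
abbrev SampleIdx (n ℓ : ℕ) : Type := Σ j : Fin n, Fin (sampleSize n ℓ j)

open Classical in
/-- A family of least size among those that satisfy `P`, or the empty family if there are none. -/
noncomputable def smallestFamily {n : ℕ} (P : Finset (Fin n) → Prop) : Finset (Fin n) :=
  if h : ∃ T, P T ∧ ∀ T', P T' → T.card ≤ T'.card then h.choose else ∅

theorem smallestFamily_spec {n : ℕ} {P : Finset (Fin n) → Prop} {T₀ : Finset (Fin n)}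
    (h₀ : P T₀) :
    P (smallestFamily P) ∧ (smallestFamily P).card ≤ T₀.card := by
  classical
  have h : ∃ T, P T ∧ ∀ T', P T' → T.card ≤ T'.card := by
    obtain ⟨T, hT, hmin⟩ := Finset.exists_min_image (Finset.univ.filter P) Finset.card
      ⟨T₀, by simpa using h₀⟩
    exact ⟨T, by simpa using hT, fun T' hT' => hmin T' (by simpa using hT')⟩
  rw [smallestFamily, dif_pos h]
  exact ⟨h.choose_spec.1, h.choose_spec.2 _ h₀⟩

namespace CoverAlg

variable {n m t : ℕ}

/-- The machine that collects the edges of the element `v`. -/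
def owner (hmt : m ≤ t) (v : Fin m) : Fin t := Fin.castLE hmt v

theorem owner_injective (hmt : m ≤ t) : Function.Injective (owner hmt) :=
  Fin.castLE_injective hmt

/-- The machine to which a word of the input belongs. -/
def target (hmt : m ≤ t) : Word n m → Option (Fin t) :=
  Sum.elim (fun e => some (owner hmt e.2)) fun _ => none

/-- The input words that belong to machine `k`. -/
def edgeMsg (hmt : m ≤ t) (mem : List (Word n m)) (k : Fin t) : List (Word n m) :=
  mem.filter fun w => target hmt w = some k

theorem sum_length_edgeMsg_le (hmt : m ≤ t) (l : List (Word n m)) :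
    ∑ k : Fin t, (edgeMsg hmt l k).length ≤ l.length := by
  induction l with
  | nil => simp [edgeMsg]
  | cons a l ih =>
    have h : ∀ k : Fin t, (edgeMsg hmt (a :: l) k).length =
        (edgeMsg hmt l k).length + if target hmt a = some k then 1 else 0 := by
      intro k
      simp only [edgeMsg, List.filter_cons, decide_eq_true_eq]
      split_ifs <;> simp
    have h1 : ∑ k : Fin t, (if target hmt a = some k then 1 else 0) ≤ 1 := by
      rcases target hmt a with _ | b <;> simp
    simp_rw [h, Finset.sum_add_distrib]
    simp only [List.length_cons]
    omega

theorem mem_edgeMsg {hmt : m ≤ t} {l : List (Fin n × Fin m)} {v w : Fin m} {S : Fin n} :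
    Sum.inl (S, w) ∈ edgeMsg hmt (l.map Sum.inl) (owner hmt v) ↔ (S, w) ∈ l ∧ w = v := by
  simp [edgeMsg, target, (owner_injective hmt).eq_iff]

theorem length_edgeMsg_owner (hmt : m ≤ t) (l : List (Fin n × Fin m)) (v : Fin m) :
    (edgeMsg hmt (l.map Sum.inl) (owner hmt v)).length = ∑ S : Fin n, l.count (S, v) := by
  induction l with
  | nil => simp [edgeMsg]
  | cons a l ih =>
    obtain ⟨S, w⟩ := a
    have h : (edgeMsg hmt (((S, w) :: l).map Sum.inl) (owner hmt v)).length =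
        (edgeMsg hmt (l.map Sum.inl) (owner hmt v)).length + if w = v then 1 else 0 := by
      simp only [edgeMsg, List.map_cons, List.filter_cons, decide_eq_true_eq, target, Sum.elim_inl,
        Option.some.injEq, (owner_injective hmt).eq_iff]
      split_ifs <;> simp
    rw [h, ih]
    simp only [List.count_cons, Finset.sum_add_distrib, beq_iff_eq, Prod.mk.injEq]
    congr 1
    by_cases hw : w = v <;> simp [hw]

/-- A machine receives at most `n` edges, since it owns at most one element. -/
theorem sum_length_edgeMsg_received_le (hmt : m ≤ t) {I : Fin n → Finset (Fin m)}
    {D : Fin t → List (Fin n × Fin m)} (hD : IsDistribution I D) (k : Fin t) :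
    ∑ i : Fin t, (edgeMsg hmt ((D i).map Sum.inl) k).length ≤ n := by
  by_cases hk : ∃ v, owner hmt v = k
  · obtain ⟨v, rfl⟩ := hk
    simp_rw [length_edgeMsg_owner]
    rw [Finset.sum_comm]
    simp_rw [hD _ v]
    calc ∑ S : Fin n, (if v ∈ I S then 1 else 0) ≤ ∑ S : Fin n, 1 :=
          Finset.sum_le_sum fun S _ => by split_ifs <;> simp
      _ = n := by simp
  · have : ∀ i, edgeMsg hmt ((D i).map Sum.inl) k = [] := by
      intro i
      rw [edgeMsg, List.filter_eq_nil_iff]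
      intro w hw
      obtain ⟨e, -, rfl⟩ := List.mem_map.1 hw
      simp only [target, Sum.elim_inl, Option.some.injEq, decide_eq_true_eq]
      exact fun h => hk ⟨_, h⟩
    simp [this]

variable [NeZero m]

/-- The word for a number below `n`, which may stand for a set or for a scale. -/
def numWord (m : ℕ) [NeZero m] (S : Fin n) : Word n m :=
  Sum.inr (Fin.castLE
    ((Nat.le_mul_of_pos_right n (Nat.pos_of_ne_zero (NeZero.ne m))).trans (Nat.le_succ _)) S)

theorem numWord_injective : Function.Injective (numWord (n := n) m) :=
  Sum.inr_injective.comp (Fin.castLE_injective _)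

/-! ### The algorithm -/

/-- The scales at which machine `k` owns a sample point, with multiplicity. -/
noncomputable def scaleMsg (hmt : m ≤ t) {ℓ : ℕ} (σ : SampleIdx n ℓ → Fin m) (k : Fin t) :
    List (Word n m) :=
  ((Finset.univ.filter fun p => owner hmt (σ p) = k).toList).map fun p => numWord m p.1

/-- The sample as a list of words; the pair of a scale and an element is encoded as an edge. -/
noncomputable def sampleWords {ℓ : ℕ} (σ : SampleIdx n ℓ → Fin m) : List (Word n m) :=
  (Finset.univ : Finset (SampleIdx n ℓ)).toList.map fun p => Sum.inl (p.1, σ p)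

open Classical in
/-- The sets that occur in the edges received. -/
noncomputable def receivedSets (inbox : Fin t → List (Word n m)) : Finset (Fin n) :=
  Finset.univ.filter fun S => ∃ i v, Sum.inl (S, v) ∈ inbox i

/-- The sum of the degree caps of the scales in a message. -/
def capSum (B : ℕ) (msg : List (Word n m)) : ℕ :=
  ∑ j : Fin n, (msg.countP fun w => w = numWord m j) * degCap n B j

open Classical in
/-- The number of sample points at scale `j`, as stored in `mem`, whose owner has reported no member
of `T` among the first `degCap n B j` sets. -/
noncomputable def missedSamples (hmt : m ≤ t) (B : ℕ) (mem : List (Word n m))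
    (inbox : Fin t → List (Word n m)) (j : Fin n) (T : Finset (Fin n)) : ℕ :=
  (mem.filter fun w => ∃ v, w = Sum.inl (j, v) ∧
    ∀ S ∈ T, numWord m S ∉ (inbox (owner hmt v)).take (degCap n B j)).length

/-- The leader's test for `T`: at the scale of its size, `T` misses at most a `lam / 4` fraction of
the sample points. -/
def Accepts (hmt : m ≤ t) (ℓ B : ℕ) (lam : ℝ) (mem : List (Word n m))
    (inbox : Fin t → List (Word n m)) (T : Finset (Fin n)) : Prop :=
  T.Nonempty ∧ ∃ j : Fin n, (j : ℕ) = Nat.log 2 T.card ∧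
    4 * (missedSamples hmt B mem inbox j T : ℝ) ≤ lam * sampleSize n ℓ j

/-- The four-round algorithm. The owners of the elements collect the edges, while the leader draws
the samples and tells the owners about them; the owners report the capped neighbourhoods of the
sampled elements to the leader; the leader finds a smallest accepted family; the last round is
idle. -/
noncomputable def alg (n : ℕ) (hmt : m ≤ t) (ℓ B : ℕ) (lam : ℝ) : DistAlg n m t 4 where
  Seed := SampleIdx n ℓ → Fin m
  leader := owner hmt 0
  step r i mem inbox σ :=
    match r with
    | 0 => (if i = owner hmt 0 then sampleWords σ else [],
        fun k => edgeMsg hmt mem k ++ if i = owner hmt 0 then scaleMsg hmt σ k else [])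
    | 1 => (mem, fun k => if k = owner hmt 0 then
        (((receivedSets inbox).sort (· ≤ ·)).take (capSum B (inbox (owner hmt 0)))).map (numWord m)
        else [])
    | 2 => ((smallestFamily (Accepts hmt ℓ B lam mem inbox)).toList.map (numWord m), fun _ => [])
    | 3 => (mem, fun _ => [])
  report mem := open Classical in Finset.univ.filter fun S => numWord m S ∈ mem

section Run

variable (hmt : m ≤ t) (ℓ B : ℕ) (lam : ℝ) (D : Fin t → List (Fin n × Fin m))
  (ω : (alg n hmt ℓ B lam).Outcome)

/-- The samples drawn by the leader in the first round. -/
def leaderSample : SampleIdx n ℓ → Fin m := ω 0 (owner hmt 0)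

theorem mem_one (i : Fin t) : ((alg n hmt ℓ B lam).config D ω 1).mem i =
    if i = owner hmt 0 then sampleWords (leaderSample hmt ℓ B lam ω) else [] := by
  split_ifs with h
  · subst h
    change (if owner hmt 0 = owner hmt 0 then sampleWords (leaderSample hmt ℓ B lam ω) else []) = _
    rw [if_pos rfl]
  · exact if_neg h

theorem inbox_one (k i : Fin t) : ((alg n hmt ℓ B lam).config D ω 1).inbox k i =
    edgeMsg hmt ((D i).map Sum.inl) k ++
      if i = owner hmt 0 then scaleMsg hmt (leaderSample hmt ℓ B lam ω) k else [] := by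
  split_ifs with h
  · subst h; exact congrArg (edgeMsg hmt ((D _).map Sum.inl) k ++ ·) (if_pos rfl)
  · exact congrArg (edgeMsg hmt ((D _).map Sum.inl) k ++ ·) (if_neg h)

theorem mem_two (i : Fin t) : ((alg n hmt ℓ B lam).config D ω 2).mem i =
    ((alg n hmt ℓ B lam).config D ω 1).mem i := rfl

theorem inbox_two (k i : Fin t) : ((alg n hmt ℓ B lam).config D ω 2).inbox k i =
    if k = owner hmt 0 then
      (((receivedSets (((alg n hmt ℓ B lam).config D ω 1).inbox i)).sort (· ≤ ·)).take
        (capSum B (((alg n hmt ℓ B lam).config D ω 1).inbox i (owner hmt 0)))).map (numWord m)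
    else [] := rfl

theorem mem_three (i : Fin t) : ((alg n hmt ℓ B lam).config D ω 3).mem i =
    (smallestFamily (Accepts hmt ℓ B lam (((alg n hmt ℓ B lam).config D ω 2).mem i)
      (((alg n hmt ℓ B lam).config D ω 2).inbox i))).toList.map (numWord m) := rfl

theorem inbox_three (k i : Fin t) : ((alg n hmt ℓ B lam).config D ω 3).inbox k i = [] := rfl

theorem mem_four (i : Fin t) : ((alg n hmt ℓ B lam).config D ω 4).mem i =
    ((alg n hmt ℓ B lam).config D ω 3).mem i := rfl

theorem inbox_four (k i : Fin t) : ((alg n hmt ℓ B lam).config D ω 4).inbox k i = [] := rfl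

end Run

/-! ### Space bounds -/

/-- The number of words that the owners report to the leader is at most the sum of the degree caps
over all sample points. -/
def reportBound (n ℓ B : ℕ) : ℕ := ∑ p : SampleIdx n ℓ, degCap n B p.1

/-- Each cap is at least `1`, so that the sample is no larger than the reports about it. -/
theorem card_sampleIdx_le {ℓ B : ℕ} (hB : 0 < B) :
    Fintype.card (SampleIdx n ℓ) ≤ reportBound n ℓ B := by
  rw [reportBound, Fintype.card_eq_sum_ones]
  exact Finset.sum_le_sum fun p _ => Nat.mul_pos hB (Nat.succ_pos _)

theorem sum_length_scaleMsg (hmt : m ≤ t) {ℓ : ℕ} (σ : SampleIdx n ℓ → Fin m) :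
    ∑ k, (scaleMsg hmt σ k).length = Fintype.card (SampleIdx n ℓ) := by
  simp only [scaleMsg, List.length_map, Finset.length_toList]
  rw [← Finset.card_univ]
  exact (Finset.card_eq_sum_card_fiberwise fun p _ => Finset.mem_univ _).symm

theorem length_scaleMsg_le (hmt : m ≤ t) {ℓ : ℕ} (σ : SampleIdx n ℓ → Fin m) (k : Fin t) :
    (scaleMsg hmt σ k).length ≤ Fintype.card (SampleIdx n ℓ) := by
  simp only [scaleMsg, List.length_map, Finset.length_toList]
  exact Finset.card_le_univ _

theorem count_scaleMsg (hmt : m ≤ t) {ℓ : ℕ} (σ : SampleIdx n ℓ → Fin m) (k : Fin t)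
    (j : Fin n) : ((scaleMsg hmt σ k).countP fun w => w = numWord m j) =
      ((Finset.univ.filter fun p => owner hmt (σ p) = k).filter fun p => p.1 = j).card := by
  have h : ∀ s : Finset (SampleIdx n ℓ),
      ((s.toList.map fun p => numWord (n := n) m p.1).countP fun w => w = numWord m j) =
        (s.filter fun p => p.1 = j).card := by
    intro s
    rw [List.countP_map, List.countP_eq_length_filter, ← Finset.length_toList]
    refine List.Perm.length_eq ?_
    rw [List.perm_ext_iff_of_nodup (s.nodup_toList.filter _) (Finset.nodup_toList _)]
    intro p
    simp [numWord_injective.eq_iff]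
  exact h _

theorem capSum_scaleMsg (hmt : m ≤ t) {ℓ : ℕ} (B : ℕ) (σ : SampleIdx n ℓ → Fin m) (k : Fin t) :
    capSum B (scaleMsg hmt σ k) =
      ∑ p ∈ Finset.univ.filter fun p => owner hmt (σ p) = k, degCap n B p.1 := by
  refine Eq.trans (Finset.sum_congr rfl fun j _ => ?_) (Finset.sum_fiberwise
    (Finset.univ.filter fun p => owner hmt (σ p) = k) (fun p : SampleIdx n ℓ => p.1)
    (fun p => degCap n B p.1))
  rw [count_scaleMsg, Finset.sum_congr rfl (g := fun _ => degCap n B j), Finset.sum_const,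
    smul_eq_mul]
  intro p hp
  rw [(Finset.mem_filter.1 hp).2]

/-- Edges do not interfere with the scales in the same message. -/
theorem capSum_edgeMsg_append (hmt : m ≤ t) (B : ℕ) (l : List (Fin n × Fin m)) (k : Fin t)
    (l' : List (Word n m)) :
    capSum B (edgeMsg hmt (l.map Sum.inl) k ++ l') = capSum B l' := by
  refine Finset.sum_congr rfl fun j _ => ?_
  rw [List.countP_append, List.countP_eq_zero.2, zero_add]
  intro w hw
  obtain ⟨e, -, rfl⟩ := List.mem_map.1 (List.mem_of_mem_filter hw)
  simp [numWord]

section Run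

variable (hmt : m ≤ t) (ℓ B : ℕ) (lam : ℝ) (D : Fin t → List (Fin n × Fin m))
  (ω : (alg n hmt ℓ B lam).Outcome)

theorem capSum_inbox_one (k : Fin t) :
    capSum B (((alg n hmt ℓ B lam).config D ω 1).inbox k (owner hmt 0)) =
      ∑ p ∈ Finset.univ.filter fun p => owner hmt (leaderSample hmt ℓ B lam ω p) = k, degCap n B p.1 := by
  rw [inbox_one, capSum_edgeMsg_append, if_pos rfl, capSum_scaleMsg]

theorem length_inbox_two_le (k i : Fin t) :
    (((alg n hmt ℓ B lam).config D ω 2).inbox k i).length ≤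
      ∑ p ∈ Finset.univ.filter fun p => owner hmt (leaderSample hmt ℓ B lam ω p) = i, degCap n B p.1 := by
  rw [inbox_two]
  split_ifs
  · rw [List.length_map, List.length_take, capSum_inbox_one]
    exact min_le_left _ _
  · simp

theorem sum_length_inbox_two_le (k : Fin t) :
    ∑ i, (((alg n hmt ℓ B lam).config D ω 2).inbox k i).length ≤ reportBound n ℓ B :=
  (Finset.sum_le_sum fun i _ => length_inbox_two_le hmt ℓ B lam D ω k i).trans
    (Finset.sum_fiberwise (s := Finset.univ) (fun p => owner hmt (leaderSample hmt ℓ B lam ω p))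
      (fun p => degCap n B p.1)).le

theorem sum_length_sent_two_le (i : Fin t) :
    ∑ k, (((alg n hmt ℓ B lam).config D ω 2).inbox k i).length ≤ reportBound n ℓ B := by
  rw [Finset.sum_eq_single (owner hmt 0)]
  · exact (length_inbox_two_le hmt ℓ B lam D ω _ i).trans
      (Finset.sum_le_sum_of_subset (Finset.subset_univ _))
  · intro k _ hk
    rw [inbox_two, if_neg hk, List.length_nil]
  · simp

theorem length_mem_one_le (i : Fin t) :
    (((alg n hmt ℓ B lam).config D ω 1).mem i).length ≤ Fintype.card (SampleIdx n ℓ) := by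
  rw [mem_one]
  split_ifs
  · simp [sampleWords]
  · simp

theorem length_mem_three_le (i : Fin t) :
    (((alg n hmt ℓ B lam).config D ω 3).mem i).length ≤ n := by
  rw [mem_three, List.length_map, Finset.length_toList]
  exact (Finset.card_le_univ _).trans_eq (Fintype.card_fin n)

theorem sum_length_inbox_one_le {I : Fin n → Finset (Fin m)} (hD : IsDistribution I D)
    (k : Fin t) : ∑ i, (((alg n hmt ℓ B lam).config D ω 1).inbox k i).length ≤
      n + Fintype.card (SampleIdx n ℓ) := by
  simp only [inbox_one, List.length_append, Finset.sum_add_distrib]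
  refine Nat.add_le_add (sum_length_edgeMsg_received_le hmt hD k) ?_
  rw [Finset.sum_eq_single (owner hmt 0)]
  · rw [if_pos rfl]
    exact length_scaleMsg_le _ _ _
  · intro i _ hi
    rw [if_neg hi, List.length_nil]
  · simp

theorem sum_length_sent_one_le (hDn : ∀ i, (D i).length ≤ n) (i : Fin t) :
    ∑ k, (((alg n hmt ℓ B lam).config D ω 1).inbox k i).length ≤
      n + Fintype.card (SampleIdx n ℓ) := by
  simp only [inbox_one, List.length_append, Finset.sum_add_distrib]
  refine Nat.add_le_add ((sum_length_edgeMsg_le hmt _).trans (by simpa using hDn i)) ?_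
  split_ifs
  · exact (sum_length_scaleMsg _ _).le
  · simp

theorem load_le (hB : 0 < B) {I : Fin n → Finset (Fin m)} (hD : IsDistribution I D)
    (hDn : ∀ i, (D i).length ≤ n) (r : Fin 4) (i : Fin t) :
    (alg n hmt ℓ B lam).load D ω r i ≤ 2 * n + 4 * reportBound n ℓ B := by
  have hM := card_sampleIdx_le (n := n) (ℓ := ℓ) hB
  have hm1 := length_mem_one_le hmt ℓ B lam D ω i
  have hm3 := length_mem_three_le hmt ℓ B lam D ω i
  have hi1 := sum_length_inbox_one_le hmt ℓ B lam D ω hD i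
  have hs1 := sum_length_sent_one_le hmt ℓ B lam D ω hDn i
  have hi2 := sum_length_inbox_two_le hmt ℓ B lam D ω i
  have hs2 := sum_length_sent_two_le hmt ℓ B lam D ω i
  have hm2 := congrArg List.length (mem_two hmt ℓ B lam D ω i)
  have hm4 := congrArg List.length (mem_four hmt ℓ B lam D ω i)
  have hi3 : ∑ k, (((alg n hmt ℓ B lam).config D ω 3).inbox i k).length = 0 := by
    simp [inbox_three]
  have hs3 : ∑ k, (((alg n hmt ℓ B lam).config D ω 3).inbox k i).length = 0 := by
    simp [inbox_three]
  have hs4 : ∑ k, (((alg n hmt ℓ B lam).config D ω 4).inbox k i).length = 0 := by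
    simp [inbox_four]
  have hm0 : (((alg n hmt ℓ B lam).config D ω 0).mem i).length ≤ n := by
    simpa [DistAlg.config] using hDn i
  have hi0 : ∑ k, (((alg n hmt ℓ B lam).config D ω 0).inbox i k).length = 0 := by
    simp [DistAlg.config]
  fin_cases r
  · change (((alg n hmt ℓ B lam).config D ω 0).mem i).length +
      ∑ k, (((alg n hmt ℓ B lam).config D ω 0).inbox i k).length +
      (((alg n hmt ℓ B lam).config D ω 1).mem i).length +
      ∑ k, (((alg n hmt ℓ B lam).config D ω 1).inbox k i).length ≤ _
    omega
  · change (((alg n hmt ℓ B lam).config D ω 1).mem i).length +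
      ∑ k, (((alg n hmt ℓ B lam).config D ω 1).inbox i k).length +
      (((alg n hmt ℓ B lam).config D ω 2).mem i).length +
      ∑ k, (((alg n hmt ℓ B lam).config D ω 2).inbox k i).length ≤ _
    omega
  · change (((alg n hmt ℓ B lam).config D ω 2).mem i).length +
      ∑ k, (((alg n hmt ℓ B lam).config D ω 2).inbox i k).length +
      (((alg n hmt ℓ B lam).config D ω 3).mem i).length +
      ∑ k, (((alg n hmt ℓ B lam).config D ω 3).inbox k i).length ≤ _
    omega
  · change (((alg n hmt ℓ B lam).config D ω 3).mem i).length +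
      ∑ k, (((alg n hmt ℓ B lam).config D ω 3).inbox i k).length +
      (((alg n hmt ℓ B lam).config D ω 4).mem i).length +
      ∑ k, (((alg n hmt ℓ B lam).config D ω 4).inbox k i).length ≤ _
    omega

end Run

end CoverAlg

/-! ### The output as a function of the samples -/

theorem log_two_card_lt {n : ℕ} (hn : 0 < n) (T : Finset (Fin n)) : Nat.log 2 T.card < n := by
  rcases Nat.eq_zero_or_pos T.card with h | h
  · simpa [h] using hn
  · calc Nat.log 2 T.card < 2 ^ Nat.log 2 T.card := Nat.lt_two_pow_self
      _ ≤ T.card := Nat.pow_log_le_self 2 h.ne'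
      _ ≤ n := by simpa using Finset.card_le_univ T

/-- The sample points at the scale of the size of `T`. -/
def sampleAt (n ℓ : ℕ) (T : Finset (Fin n)) : Finset (SampleIdx n ℓ) :=
  Finset.univ.filter fun p => (p.1 : ℕ) = Nat.log 2 T.card

theorem card_sampleAt {n : ℕ} (hn : 0 < n) (ℓ : ℕ) (T : Finset (Fin n)) :
    (sampleAt n ℓ T).card = sampleSize n ℓ (Nat.log 2 T.card) := by
  have h : sampleAt n ℓ T = (Finset.univ : Finset (Fin (sampleSize n ℓ (Nat.log 2 T.card)))).map
      ⟨fun l => ⟨⟨_, log_two_card_lt hn T⟩, l⟩, fun a b h => by simpa using h⟩ := by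
    ext ⟨⟨j, hj⟩, l⟩
    simp only [sampleAt, Finset.mem_filter, Finset.mem_univ, true_and, Finset.mem_map]
    constructor
    · rintro rfl
      exact ⟨l, rfl⟩
    · rintro ⟨l', h⟩
      have := congrArg (fun p : SampleIdx n ℓ => (p.1 : ℕ)) h
      exact this.symm
  rw [h, Finset.card_map, Finset.card_univ, Fintype.card_fin]

/-- The number of sample points at the scale of `T` that `T` misses in the capped instance. -/
def sampleMissed {n m ℓ : ℕ} (I : Fin n → Finset (Fin m)) (B : ℕ) (σ : SampleIdx n ℓ → Fin m)
    (T : Finset (Fin n)) : ℕ :=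
  ((sampleAt n ℓ T).filter fun p => σ p ∈ missed I (degCap n B (Nat.log 2 T.card)) T).card

/-- The leader's test for `T`, as a property of the samples: `T` misses at most a `lam / 4` fraction
of the sample at the scale of its size. -/
def SampleAccepts {n m ℓ : ℕ} (I : Fin n → Finset (Fin m)) (B : ℕ) (lam : ℝ)
    (σ : SampleIdx n ℓ → Fin m) (T : Finset (Fin n)) : Prop :=
  T.Nonempty ∧ 4 * (sampleMissed I B σ T : ℝ) ≤ lam * (sampleAt n ℓ T).card

namespace CoverAlg

variable {n m t : ℕ} [NeZero m]

section Run

variable (hmt : m ≤ t) (ℓ B : ℕ) (lam : ℝ) {D : Fin t → List (Fin n × Fin m)}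
  (ω : (alg n hmt ℓ B lam).Outcome) {I : Fin n → Finset (Fin m)}

theorem receivedSets_inbox_one (hD : IsDistribution I D) (v : Fin m) :
    receivedSets (((alg n hmt ℓ B lam).config D ω 1).inbox (owner hmt v)) = nbhd I v := by
  ext S
  have h1 : ∀ i w, Sum.inl (S, w) ∈ ((alg n hmt ℓ B lam).config D ω 1).inbox (owner hmt v) i ↔
      (S, w) ∈ D i ∧ w = v := by
    intro i w
    rw [inbox_one, List.mem_append, mem_edgeMsg, or_iff_left]
    split_ifs <;> simp [scaleMsg, numWord]
  have h2 : (∃ i, (S, v) ∈ D i) ↔ v ∈ I S := by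
    have := hD S v
    constructor
    · rintro ⟨i, hi⟩
      by_contra hv
      rw [if_neg hv, Finset.sum_eq_zero_iff] at this
      exact (List.count_pos_iff.2 hi).ne' (this i (Finset.mem_univ _))
    · intro hv
      rw [if_pos hv] at this
      by_contra! hno
      rw [Finset.sum_eq_zero fun i _ => List.count_eq_zero.2 (hno i)] at this
      omega
  simp only [receivedSets, nbhd, Finset.mem_filter, Finset.mem_univ, true_and, h1, ← h2]
  constructor
  · rintro ⟨i, w, hi, rfl⟩
    exact ⟨i, hi⟩
  · rintro ⟨i, hi⟩
    exact ⟨i, v, hi, rfl⟩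

/-- The report of the owner of a sample point reaches at least up to the degree cap at its scale. -/
theorem take_inbox_two (hD : IsDistribution I D) (p : SampleIdx n ℓ) :
    (((alg n hmt ℓ B lam).config D ω 2).inbox (owner hmt 0)
      (owner hmt (leaderSample hmt ℓ B lam ω p))).take (degCap n B p.1) =
    (cappedNbhd I (degCap n B p.1) (leaderSample hmt ℓ B lam ω p)).map (numWord m) := by
  rw [inbox_two, if_pos rfl, receivedSets_inbox_one hmt ℓ B lam ω hD, capSum_inbox_one,
    ← List.map_take, List.take_take, min_eq_left, cappedNbhd]
  exact Finset.single_le_sum (f := fun p : SampleIdx n ℓ => degCap n B p.1)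
    (fun _ _ => Nat.zero_le _) (by simp)

theorem missedSamples_eq (hD : IsDistribution I D) {j : Fin n} {T : Finset (Fin n)}
    (hj : (j : ℕ) = Nat.log 2 T.card) :
    missedSamples hmt B (((alg n hmt ℓ B lam).config D ω 2).mem (owner hmt 0))
      (((alg n hmt ℓ B lam).config D ω 2).inbox (owner hmt 0)) j T =
    sampleMissed I B (leaderSample hmt ℓ B lam ω) T := by
  classical
  rw [missedSamples, mem_two, mem_one, if_pos rfl, sampleWords, List.filter_map, List.length_map,
    sampleMissed, ← Finset.length_toList]
  refine List.Perm.length_eq ?_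
  rw [List.perm_ext_iff_of_nodup ((Finset.nodup_toList _).filter _) (Finset.nodup_toList _)]
  intro p
  simp only [List.mem_filter, Finset.mem_toList, Finset.mem_univ, true_and, Function.comp_apply,
    decide_eq_true_eq, Sum.inl.injEq, Prod.mk.injEq, Finset.mem_filter, sampleAt, missed, ← hj]
  constructor
  · rintro ⟨v, ⟨rfl, rfl⟩, h⟩
    refine ⟨rfl, fun S hS hmem => h S hS ?_⟩
    rw [take_inbox_two hmt ℓ B lam ω hD]
    exact List.mem_map_of_mem hmem
  · rintro ⟨h1, h⟩
    obtain rfl : p.1 = j := Fin.ext h1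
    refine ⟨_, ⟨rfl, rfl⟩, fun S hS hmem => h S hS ?_⟩
    rw [take_inbox_two hmt ℓ B lam ω hD, List.mem_map_of_injective numWord_injective] at hmem
    exact hmem

/-- The output depends only on the samples that the leader draws in the first round, and not on the
distribution of the edges. -/
theorem output_eq (hn : 0 < n) (hD : IsDistribution I D) :
    (alg n hmt ℓ B lam).output D ω =
      smallestFamily (SampleAccepts I B lam (leaderSample hmt ℓ B lam ω)) := by
  have h : Accepts hmt ℓ B lam (((alg n hmt ℓ B lam).config D ω 2).mem (owner hmt 0))
      (((alg n hmt ℓ B lam).config D ω 2).inbox (owner hmt 0)) =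
      SampleAccepts I B lam (leaderSample hmt ℓ B lam ω) := by
    funext T
    rw [Accepts, SampleAccepts, card_sampleAt hn]
    refine propext (and_congr_right fun _ => ⟨?_, fun hT => ?_⟩)
    · rintro ⟨j, hj, hT⟩
      rwa [missedSamples_eq hmt ℓ B lam ω hD hj, hj] at hT
    · refine ⟨⟨_, log_two_card_lt hn T⟩, rfl, ?_⟩
      rwa [missedSamples_eq hmt ℓ B lam ω hD rfl]
  classical
  ext S
  change S ∈ Finset.univ.filter (fun S =>
    numWord m S ∈ ((alg n hmt ℓ B lam).config D ω 4).mem (owner hmt 0)) ↔ _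
  rw [Finset.mem_filter, mem_four, mem_three, h]
  simp [numWord_injective.eq_iff]

end Run

end CoverAlg

open Classical in
/-- If the output is a function of one independent component of the randomness, which is uniform
on `α`, then its distribution is computed on `α`. -/
theorem DistAlg.prob_eq_of_equiv {n m t R : ℕ} (A : DistAlg n m t R)
    (D : Fin t → List (Fin n × Fin m)) {α β : Type*} [Fintype α] [Finite β] [Nonempty β]
    (e : A.Outcome ≃ α × β) (g : α → Finset (Fin n)) (h : ∀ ω, A.output D ω = g (e ω).1)
    (P : Finset (Fin n) → Prop) :
    A.prob D P = ((Finset.univ.filter fun σ => P (g σ)).card : ℝ) / Fintype.card α := by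
  have := Fintype.ofFinite β
  let := A.seedFintype
  have h1 : (Finset.univ.filter fun ω : A.Outcome => P (A.output D ω)).card =
      ((Finset.univ.filter fun σ => P (g σ)) ×ˢ (Finset.univ : Finset β)).card :=
    Finset.card_equiv e fun ω => by simp [h]
  have h2 : (Fintype.card β : ℝ) ≠ 0 := by exact_mod_cast Fintype.card_ne_zero
  rw [DistAlg.prob, h1, Fintype.card_congr e, Finset.card_product, Fintype.card_prod,
    Finset.card_univ]
  push_cast
  rw [mul_div_mul_right _ _ h2]

open Classical in
theorem CoverAlg.prob_alg {n m t : ℕ} [NeZero m] (hn : 0 < n) (hmt : m ≤ t) (ℓ B : ℕ) (lam : ℝ)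
    {I : Fin n → Finset (Fin m)} {D : Fin t → List (Fin n × Fin m)} (hD : IsDistribution I D)
    (P : Finset (Fin n) → Prop) :
    (alg n hmt ℓ B lam).prob D P =
      ((Finset.univ.filter fun σ : SampleIdx n ℓ → Fin m =>
        P (smallestFamily (SampleAccepts I B lam σ))).card : ℝ) /
        Fintype.card (SampleIdx n ℓ → Fin m) :=
  (alg n hmt ℓ B lam).prob_eq_of_equiv D
    ((Equiv.curry (Fin 4) (Fin t) (SampleIdx n ℓ → Fin m)).symm.trans
      (Equiv.funSplitAt ((0 : Fin 4), owner hmt 0) (SampleIdx n ℓ → Fin m)))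
    (fun σ => smallestFamily (SampleAccepts I B lam σ)) (fun ω => output_eq hmt ℓ B lam ω hn hD) P

/-! ### Correctness with high probability -/

theorem card_mul_le_card_sampleAt {n : ℕ} (ℓ : ℕ) {T : Finset (Fin n)}
    (hT : T.Nonempty) : T.card * ℓ ≤ (sampleAt n ℓ T).card := by
  have hTn : T.card ≤ n := by simpa using Finset.card_le_univ T
  rw [card_sampleAt (hT.card_pos.trans_le hTn), sampleSize,
    if_pos ((Nat.pow_log_le_self 2 hT.card_pos.ne').trans hTn)]
  exact Nat.mul_le_mul_right _ (Nat.lt_pow_succ_log_self (by norm_num) _).le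

theorem mul_le_degCap_mul {n B k : ℕ} (hk : 0 < k) : B * n ≤ degCap n B (Nat.log 2 k) * k := by
  have h1 := Nat.pow_log_le_self 2 hk.ne'
  have h2 : n ≤ (n / 2 ^ Nat.log 2 k + 1) * 2 ^ Nat.log 2 k :=
    (Nat.lt_mul_of_div_lt (Nat.lt_succ_self _) (by positivity)).le
  rw [degCap, mul_assoc]
  exact Nat.mul_le_mul_left _ (h2.trans (Nat.mul_le_mul_left _ h1))

open Finset in
open Classical in
/-- Union bound over all families: with probability at least `1 - 1 / n`, none is accepted that
misses a `lam` fraction of the elements. -/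
theorem card_bad_accepted_le {n m ℓ : ℕ} (hn : 2 ≤ n) (hm : 0 < m) (I : Fin n → Finset (Fin m))
    (B : ℕ) {lam : ℝ} (hlam : 0 < lam) (hℓ : 12 * (1 + Real.log n) ≤ lam * ℓ) :
    ((univ.filter fun σ : SampleIdx n ℓ → Fin m => ∃ T, SampleAccepts I B lam σ T ∧
      lam * m ≤ (missed I (degCap n B (Nat.log 2 T.card)) T).card).card : ℝ) ≤
      1 / n * Fintype.card (SampleIdx n ℓ → Fin m) := by
  have hn' : (0 : ℝ) < n := by positivity
  have hlog : 0 ≤ Real.log n := Real.log_natCast_nonneg n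
  have hsub : (univ.filter fun σ : SampleIdx n ℓ → Fin m => ∃ T, SampleAccepts I B lam σ T ∧
      lam * m ≤ (missed I (degCap n B (Nat.log 2 T.card)) T).card) ⊆
      ((univ : Finset (Finset (Fin n))).filter (·.Nonempty)).biUnion fun T =>
        univ.filter fun σ => SampleAccepts I B lam σ T ∧
          lam * m ≤ (missed I (degCap n B (Nat.log 2 T.card)) T).card := by
    intro σ hσ
    obtain ⟨T, hT, hm⟩ := (mem_filter.1 hσ).2
    simp only [mem_biUnion, mem_filter, mem_univ, true_and]
    exact ⟨T, hT.1, hT, hm⟩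
  have hone : ∀ T ∈ (univ : Finset (Finset (Fin n))).filter (·.Nonempty),
      ((univ.filter fun σ : SampleIdx n ℓ → Fin m => SampleAccepts I B lam σ T ∧
        lam * m ≤ (missed I (degCap n B (Nat.log 2 T.card)) T).card).card : ℝ) ≤
      (((n : ℝ) ^ 3)⁻¹) ^ T.card * Fintype.card (SampleIdx n ℓ → Fin m) := by
    intro T hT
    have hne := (mem_filter.1 hT).2
    by_cases hbad : lam * m ≤ (missed I (degCap n B (Nat.log 2 T.card)) T).card
    · have hfew := card_few_hits_le hm (sampleAt n ℓ T) _ hbad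
      refine (Nat.cast_le.2 (card_le_card ?_)).trans (hfew.trans ?_)
      · intro σ hσ
        exact mem_filter.2 ⟨mem_univ _, (mem_filter.1 hσ).2.1.2⟩
      · gcongr
        have hA : (T.card : ℝ) * ℓ ≤ (sampleAt n ℓ T).card := by
          exact_mod_cast card_mul_le_card_sampleAt ℓ hne
        have hpow : (((n : ℝ) ^ 3)⁻¹) ^ T.card = Real.exp (-(3 * T.card * Real.log n)) := by
          rw [Real.exp_neg, mul_right_comm, mul_comm, Real.exp_nat_mul, inv_pow]
          congr 2
          rw [mul_comm, Real.exp_mul, Real.exp_log hn']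
          norm_cast
        rw [hpow]
        apply Real.exp_le_exp.2
        have hc : (0 : ℝ) ≤ T.card := Nat.cast_nonneg _
        nlinarith [mul_le_mul_of_nonneg_left hA hlam.le, mul_le_mul_of_nonneg_left hℓ hc]
    · rw [filter_eq_empty_iff.2 (fun σ _ h => hbad h.2), card_empty, Nat.cast_zero]
      positivity
  refine (Nat.cast_le.2 ((card_le_card hsub).trans card_biUnion_le)).trans ?_
  push_cast
  refine (sum_le_sum hone).trans ?_
  rw [← sum_mul]
  gcongr
  exact sum_nonempty_pow_card_le hn

open Classical in
/-- For all but a `2 / n` fraction of the samples, a smallest accepted family is no larger than a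
smallest set cover and covers a `1 - lam` fraction of the elements. -/
theorem card_smallestFamily_fails_le {n m ℓ B : ℕ} (hn : 2 ≤ n) (hm : 0 < m)
    (I : Fin n → Finset (Fin m)) (hI : ∀ v, ∃ S, v ∈ I S) {lam α : ℝ} (hlam : 0 < lam)
    (hlam1 : lam ≤ 1) (hα : 1 ≤ α) (hℓ : 12 * (1 + Real.log n) ≤ lam * ℓ)
    (hB : 2 / (lam / 24) ^ 2 ≤ B) :
    ((Finset.univ.filter fun σ : SampleIdx n ℓ → Fin m =>
      ¬ IsApproxOutlierCover α lam I (smallestFamily (SampleAccepts I B lam σ))).card : ℝ) ≤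
      2 / n * Fintype.card (SampleIdx n ℓ → Fin m) := by
  have hn' : (0 : ℝ) < n := by positivity
  have hlog : 0 ≤ Real.log n := Real.log_natCast_nonneg n
  obtain ⟨T, hT, hmin⟩ := Finset.exists_min_image
    (Finset.univ.filter fun T : Finset (Fin n) => IsSetCover I T) Finset.card
    ⟨Finset.univ, Finset.mem_filter.2 ⟨Finset.mem_univ _, by
      rw [IsSetCover]
      ext v
      simpa using hI v⟩⟩
  replace hT := (Finset.mem_filter.1 hT).2
  have hTpos : 0 < T.card := by
    rw [Finset.card_pos, Finset.nonempty_iff_ne_empty]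
    rintro rfl
    have : (⟨0, hm⟩ : Fin m) ∈ (∅ : Finset (Fin n)).biUnion I := by rw [hT]; simp
    simp at this
  -- with `γ = lam / 24`, the family misses at most a `lam / 12` fraction, a third of the threshold
  -- of the test
  obtain ⟨T₀, hcard, hmiss⟩ := exists_card_eq_missed_le I T hT (γ := lam / 24)
    (d := degCap n B (Nat.log 2 T.card)) (by positivity) (by linarith) hTpos (by
      calc 2 / (lam / 24) ^ 2 * n ≤ B * n := by gcongr
        _ ≤ _ := by exact_mod_cast mul_le_degCap_mul hTpos)
  have hT₀ : T₀.Nonempty := by rw [← Finset.card_pos]; omega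
  -- `T₀` is judged at the scale of its own size, which is that of `T`
  rw [← hcard] at hmiss
  have hmany := card_many_hits_le (ι := SampleIdx n ℓ) hm (sampleAt n ℓ T₀) _ (q := lam)
    (hmiss.trans_eq (by ring))
  have hexp : Real.exp (-(lam * (sampleAt n ℓ T₀).card / 12)) ≤ 1 / n := by
    have hA : (T₀.card : ℝ) * ℓ ≤ (sampleAt n ℓ T₀).card := by
      exact_mod_cast card_mul_le_card_sampleAt ℓ hT₀
    have h1 : (1 : ℝ) ≤ T₀.card := by exact_mod_cast hT₀.card_pos
    have h2 : (ℓ : ℝ) ≤ (sampleAt n ℓ T₀).card := by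
      have : (0 : ℝ) ≤ ℓ := Nat.cast_nonneg _
      nlinarith
    calc _ ≤ Real.exp (-Real.log n) := by
          apply Real.exp_le_exp.2
          nlinarith
      _ = _ := by rw [Real.exp_neg, Real.exp_log hn', one_div]
  have hbad := card_bad_accepted_le hn hm I B hlam hℓ
  have hsub : (Finset.univ.filter fun σ : SampleIdx n ℓ → Fin m =>
      ¬ IsApproxOutlierCover α lam I (smallestFamily (SampleAccepts I B lam σ))) ⊆
      (Finset.univ.filter fun σ : SampleIdx n ℓ → Fin m => ∃ T, SampleAccepts I B lam σ T ∧
        lam * m ≤ (missed I (degCap n B (Nat.log 2 T.card)) T).card) ∪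
      (Finset.univ.filter fun σ : SampleIdx n ℓ → Fin m =>
        ¬ 4 * (((sampleAt n ℓ T₀).filter fun p =>
          σ p ∈ missed I (degCap n B (Nat.log 2 T₀.card)) T₀).card : ℝ) ≤
          lam * (sampleAt n ℓ T₀).card) := by
    intro σ hσ
    replace hσ := (Finset.mem_filter.1 hσ).2
    rw [Finset.mem_union, Finset.mem_filter, Finset.mem_filter]
    by_contra! hno
    obtain ⟨hno1, hno2⟩ := hno
    obtain ⟨hacc, hle⟩ := smallestFamily_spec
      (P := SampleAccepts I B lam σ) ⟨hT₀, hno2 (Finset.mem_univ _)⟩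
    refine hσ ⟨?_, fun T' hT' => ?_⟩
    · have h1 := hno1 (Finset.mem_univ _) _ hacc
      have h2 : (m : ℝ) ≤ _ := Nat.cast_le.2 (coverage_add_missed_ge I
        (degCap n B (Nat.log 2 (smallestFamily (SampleAccepts I B lam σ)).card))
        (smallestFamily (SampleAccepts I B lam σ)))
      push_cast at h2
      rw [IsOutlierCover]
      linarith
    · have h1 : (smallestFamily (SampleAccepts I B lam σ)).card ≤ T'.card :=
        hle.trans (hcard.trans_le (hmin T' (by simpa using hT')))
      have h2 : ((smallestFamily (SampleAccepts I B lam σ)).card : ℝ) ≤ T'.card := by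
        exact_mod_cast h1
      have h3 : (0 : ℝ) ≤ T'.card := Nat.cast_nonneg _
      nlinarith
  have hN : (0 : ℝ) ≤ Fintype.card (SampleIdx n ℓ → Fin m) := Nat.cast_nonneg _
  have hle := (Nat.cast_le (α := ℝ)).2
    ((Finset.card_le_card hsub).trans (Finset.card_union_le _ _))
  push_cast at hle
  have h3 := mul_le_mul_of_nonneg_right hexp hN
  calc _ ≤ _ := hle
    _ ≤ 1 / n * Fintype.card (SampleIdx n ℓ → Fin m) +
        1 / n * Fintype.card (SampleIdx n ℓ → Fin m) := add_le_add hbad (hmany.trans h3)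
    _ = _ := by ring

/-! ### The constants -/

/-- The samples are larger at larger scales and the caps are smaller, so that each of the
`O(log n)` scales contributes `O(n * ℓ)` words. -/
theorem CoverAlg.reportBound_le (n ℓ B : ℕ) :
    reportBound n ℓ B ≤ (Nat.log 2 n + 1) * (4 * ℓ * B * n) := by
  have h1 : reportBound n ℓ B = ∑ j : Fin n, sampleSize n ℓ j * degCap n B j := by
    rw [reportBound, Fintype.sum_sigma]
    simp
  have h2 : ∀ j : Fin n, sampleSize n ℓ j * degCap n B j ≤
      if 2 ^ (j : ℕ) ≤ n then 4 * ℓ * B * n else 0 := by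
    intro j
    rw [sampleSize, degCap]
    split_ifs with h
    · have h3 : 2 ^ (j : ℕ) * (n / 2 ^ (j : ℕ)) ≤ n := Nat.mul_div_le _ _
      calc 2 ^ ((j : ℕ) + 1) * ℓ * (B * (n / 2 ^ (j : ℕ) + 1))
          = 2 * ℓ * B * (2 ^ (j : ℕ) * (n / 2 ^ (j : ℕ)) + 2 ^ (j : ℕ)) := by ring
        _ ≤ 2 * ℓ * B * (n + n) := by gcongr
        _ = _ := by ring
    · simp
  have h3 : (Finset.univ.filter fun j : Fin n => 2 ^ (j : ℕ) ≤ n).card ≤ Nat.log 2 n + 1 := by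
    rw [← Finset.card_range (Nat.log 2 n + 1)]
    refine Finset.card_le_card_of_injOn (fun j => (j : ℕ)) (fun j hj => ?_)
      (Fin.val_injective.injOn)
    have hj' : 2 ^ (j : ℕ) ≤ n := by simpa using hj
    have := Nat.le_log_of_pow_le (by norm_num) hj'
    simpa [Nat.lt_succ_iff] using this
  rw [h1]
  refine (Finset.sum_le_sum fun j _ => h2 j).trans ?_
  rw [← Finset.sum_filter, Finset.sum_const, smul_eq_mul]
  exact Nat.mul_le_mul_right _ h3

theorem natLog_two_le {n : ℕ} (hn : 1 ≤ n) : (Nat.log 2 n : ℝ) ≤ 2 * Real.log n := by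
  have h1 : ((2 ^ Nat.log 2 n : ℕ) : ℝ) ≤ n := by
    exact_mod_cast Nat.pow_log_le_self 2 (by omega)
  have h2 := Real.log_le_log (by positivity) h1
  push_cast at h2
  rw [Real.log_pow] at h2
  have h3 := Real.log_two_gt_d9
  have h4 : (0 : ℝ) ≤ Nat.log 2 n := Nat.cast_nonneg _
  nlinarith

theorem mainTheorem2 :
    ∃ c : ℕ, ∀ ε lam : ℝ, 0 < ε → ε ≤ 1 → 0 < lam → 1 ≤ (1 + ε) * Real.log (1 / lam) →
      ∃ C : ℝ, ∀ n m t : ℕ, 1 ≤ n → 1 ≤ m → m ≤ t →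
        ∃ A : DistAlg n m t 4,
          ∀ I : Fin n → Finset (Fin m), (∀ v : Fin m, ∃ S : Fin n, v ∈ I S) →
          ∀ D : Fin t → List (Fin n × Fin m), IsDistribution I D → (∀ i, (D i).length ≤ n) →
            (∀ (ω : A.Outcome) (r : Fin 4) (i : Fin t),
              (A.load D ω r i : ℝ) ≤ C * n * (1 + Real.log n) ^ c) ∧
            1 - 2 / (n : ℝ) ≤
              A.prob D (IsApproxOutlierCover ((1 + ε) * Real.log (1 / lam)) lam I) := by
  refine ⟨2, fun ε lam hε _ hlam hα => ?_⟩
  have hlam1 : lam ≤ 1 := by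
    by_contra! h
    have : Real.log (1 / lam) ≤ 0 :=
      Real.log_nonpos (by positivity) ((div_le_one hlam).2 h.le)
    nlinarith
  set B : ℕ := ⌈2 / (lam / 24) ^ 2⌉₊
  have hB : 2 / (lam / 24) ^ 2 ≤ B := Nat.le_ceil _
  have hB0 : 0 < B := Nat.ceil_pos.2 (by positivity)
  refine ⟨2 + 32 * (12 / lam + 1) * B, fun n m t hn hm hmt => ?_⟩
  have : NeZero m := ⟨by omega⟩
  have hlog : 0 ≤ Real.log n := Real.log_natCast_nonneg n
  set ℓ : ℕ := ⌈12 * (1 + Real.log n) / lam⌉₊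
  have hℓ : 12 * (1 + Real.log n) ≤ lam * ℓ := by
    have := Nat.le_ceil (12 * (1 + Real.log n) / lam)
    rwa [div_le_iff₀ hlam, mul_comm _ lam] at this
  have hℓu : (ℓ : ℝ) ≤ (12 / lam + 1) * (1 + Real.log n) := by
    have := Nat.ceil_lt_add_one (a := 12 * (1 + Real.log n) / lam) (by positivity)
    calc (ℓ : ℝ) ≤ 12 * (1 + Real.log n) / lam + 1 := this.le
      _ ≤ 12 * (1 + Real.log n) / lam + (1 + Real.log n) := by linarith
      _ = _ := by ring
  refine ⟨CoverAlg.alg n hmt ℓ B lam, fun I hI D hD hDn => ⟨fun ω r i => ?_, ?_⟩⟩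
  · have h1 : ((CoverAlg.alg n hmt ℓ B lam).load D ω r i : ℝ) ≤ _ := Nat.cast_le.2
      ((CoverAlg.load_le hmt ℓ B lam D ω hB0 hD hDn r i).trans (Nat.add_le_add_left
        (Nat.mul_le_mul_left 4 (CoverAlg.reportBound_le n ℓ B)) _))
    refine h1.trans ?_
    push_cast
    have h2 : (Nat.log 2 n : ℝ) + 1 ≤ 2 * (1 + Real.log n) := by
      linarith [natLog_two_le hn]
    calc 2 * (n : ℝ) + 4 * ((Nat.log 2 n + 1) * (4 * ℓ * B * n))
        ≤ 2 * n * (1 + Real.log n) ^ 2 + 4 * (2 * (1 + Real.log n) *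
          (4 * ((12 / lam + 1) * (1 + Real.log n)) * B * n)) := by
          refine add_le_add (le_mul_of_one_le_right (by positivity)
            (one_le_pow₀ (by linarith))) ?_
          gcongr
      _ = _ := by ring
  · classical
    rw [CoverAlg.prob_alg hn hmt ℓ B lam hD]
    rcases Nat.lt_or_ge n 2 with hn2 | hn2
    · -- the bound to be shown is negative for `n = 1`
      obtain rfl : n = 1 := by omega
      refine le_trans (by norm_num) (div_nonneg (Nat.cast_nonneg _) (Nat.cast_nonneg _))
    · have hfail := card_smallestFamily_fails_le hn2 hm I hI hlam hlam1 hα hℓ hB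
      have hN : (0 : ℝ) < Fintype.card (SampleIdx n ℓ → Fin m) := by
        exact_mod_cast Fintype.card_pos
      have hsplit := Finset.card_filter_add_card_filter_not
        (s := (Finset.univ : Finset (SampleIdx n ℓ → Fin m))) (fun σ =>
          IsApproxOutlierCover ((1 + ε) * Real.log (1 / lam)) lam I
            (smallestFamily (SampleAccepts I B lam σ)))
      rw [Finset.card_univ] at hsplit
      rw [le_div_iff₀ hN, sub_mul, one_mul, ← hsplit]
      rw [← hsplit] at hfail
      push_cast at hfail ⊢
      linarith
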